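/- Let $r,N\in\mathbb N=\{0,1,2,\dots\}$ and let $n\ge r+2$. For $x,y\in S^{n-1}$ and $z=(z_1,\dots,z_r)\in (S^{n-1})^r$ put $\chi=(z_j^\top x)_{j}$, $\upsilon=(z_j^\top y)_{j}\in\mathbb R^r$ and $Z=(z_j^\top z_k)_{j,k}\in\mathbb R^{r\times r}$, and let $\mathcal Y^r$ be the set of all matrices $Z$ arising in this way. For $\alpha\in\mathbb R$ let $P_i^\alpha$ be the Gegenbauer polynomials: $P_0^\alpha(t)=1$, $P_1^\alpha(t)=2\alpha t$, and $iP_i^\alpha(t)=2t(i+\alpha-1)P_{i-1}^\alpha(t)-(i+2\alpha-2)P_{i-2}^\alpha(t)$ for $i\ge 2$. Let $m^{d}(X)$ denote the vector of all monomials of degree at most $d$ in the variables $X=(X_1,\dots,X_r)$. Let $F:(S^{n-1})^{r+2}\to\mathbb R$ be continuous and suppose that $$F(x,y,z)=\sum_{i\ge 0}c_i(\chi,\upsilon,Z)\,P_i^{\frac{n-r}{2}-1}\!\left(\frac{x^\top y-\chi^\top Z^{-1}\upsilon}{\sqrt{(1-\chi^\top Z^{-1}\chi)(1-\upsilon^\top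 Z^{-1}\upsilon)}}\right)$$ for all $(x,y,z)$ at which the right-hand side is defined, i.e. with $\det Z\ne0$, $\chi^\top Z^{-1}\chi\neq1$ and $\upsilon^\top Z^{-1}\upsilon\ne 1$, where (for these $\chi,\upsilon,Z$) $c_i=0$ for $i>N$ and, for $i\le N$, $$c_i(\chi,\upsilon,Z)=m^{d_i}(\chi)^\top C_i(Z)\,m^{d_i}(\upsilon)\,(\det Z)^i\,\sqrt{(1-\chi^\top Z^{-1}\chi)(1-\upsilon^\top Z^{-1}\upsilon)}^{\;i}$$ with some $d_i\in\mathbb N$ and real matrices $C_i(Z)$ that are symmetric positive semidefinite for every $Z\in\mathcal Y^r$. Then $F$ is 2-PSD, that is, $F$ is continuous and for every $z\in(S^{n-1})^r$ the function $(x,y)\mapsto F(x,y,z)$ is a continuous symmetric kernel on $S^{n-1}$ whose restriction to every finite subset of $S^{n-1}$ is a positive semidefinite matrix; and $F$ is invariant under the orthogonal group $O_n$ acting simultaneously on all $r+2$ arguments. If moreover the entries of the matrices $C_i(Z)$, $i\le N$, are polynomials in the entries of $Z\in\mathcal Y^r$, then there is one real polynomial in $\binom{r+2}{2}$ variables whose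 value at the pairwise inner products of $x,y,z_1,\dots,z_r$ is $F(x,y,z)$, for all $x,y,z_1,\dots,z_r\in S^{n-1}$. -/

import Mathlib

open scoped Matrix

/-- Euclidean space `ℝⁿ`. -/
abbrev Euc (n : ℕ) : Type := EuclideanSpace ℝ (Fin n)

/-- The unit sphere `S^{n-1}` of `ℝⁿ`. -/
abbrev Sph (n : ℕ) : Type := Metric.sphere (0 : Euc n) 1

section Kernels

variable {V : Type*} [TopologicalSpace V]

/-- A positive semidefinite kernel on `V`: a continuous symmetric real function on `V × V` whose
restriction to every finite subset `U` of `V` is a positive semidefinite matrix. -/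
def IsPSDKernel (K : V → V → ℝ) : Prop :=
  Continuous (fun p : V × V => K p.1 p.2) ∧
  (∀ x y, K x y = K y x) ∧
  ∀ U : Finset V, (Matrix.of fun a b : U => K a b).PosSemidef

/-- The tuple `(x, y, z_1, …, z_r)`. -/
def tuple {W : Type*} {r : ℕ} (x y : W) (z : Fin r → W) : Fin (r + 2) → W :=
  Matrix.vecCons x (Matrix.vecCons y z)

/-- A tensor of order `r + 2` on `V` is 2-PSD if it is continuous and, for every value of the last
`r` arguments, is a positive semidefinite kernel in the first two. -/
def Is2PSD {r : ℕ} (F : (Fin (r + 2) → V) → ℝ) : Prop :=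
  Continuous F ∧ ∀ z : Fin r → V, IsPSDKernel fun x y => F (tuple x y z)

end Kernels

/-- The action of an orthogonal transformation on the unit sphere. -/
noncomputable def sphereRotate {n : ℕ} (g : Euc n ≃ₗᵢ[ℝ] Euc n) (x : Sph n) : Sph n :=
  ⟨g x, by simp⟩

/-- Invariance of a function on `(S^{n-1})^d` under the diagonal action of `O_n`. -/
def IsOrthogonalInvariant {n d : ℕ} (F : (Fin d → Sph n) → ℝ) : Prop :=
  ∀ (g : Euc n ≃ₗᵢ[ℝ] Euc n) (v : Fin d → Sph n), F (fun j => sphereRotate g (v j)) = F v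

/-- The Gegenbauer polynomial `P_d^α` of order `α` and degree `d`:
`P_0 = 1`, `P_1 = 2αt`, `d P_d = 2t(d+α-1) P_{d-1} - (d+2α-2) P_{d-2}`. -/
noncomputable def gegenbauer (α : ℝ) : ℕ → Polynomial ℝ
  | 0 => 1
  | 1 => Polynomial.C (2 * α) * Polynomial.X
  | d + 2 =>
      Polynomial.C (((d + 2 : ℕ) : ℝ)⁻¹) *
        (Polynomial.C (2 * (((d + 2 : ℕ) : ℝ) + α - 1)) * Polynomial.X * gegenbauer α (d + 1)
          - Polynomial.C (((d + 2 : ℕ) : ℝ) + 2 * α - 2) * gegenbauer α d)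

/-- The Gram matrix `Z = zᵀz`. -/
noncomputable def gramMat {n r : ℕ} (z : Fin r → Sph n) : Matrix (Fin r) (Fin r) ℝ :=
  Matrix.of fun j k => inner ℝ (z j : Euc n) (z k : Euc n)

/-- The vector `zᵀx` of the inner products of `x` with `z_1, …, z_r`. -/
noncomputable def ipVec {n r : ℕ} (z : Fin r → Sph n) (x : Sph n) : Fin r → ℝ :=
  fun j => inner ℝ (z j : Euc n) (x : Euc n)

/-- The set `𝒴^r` of Gram matrices of `r`-tuples of points of `S^{n-1}`. -/
def gramSet (n r : ℕ) : Set (Matrix (Fin r) (Fin r) ℝ) :=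
  {Y | ∃ z : Fin r → Sph n, Y = gramMat z}

/-- The factor `1 - χᵀ Z⁻¹ χ`. -/
noncomputable def schurFactor {r : ℕ} (Z : Matrix (Fin r) (Fin r) ℝ) (χ : Fin r → ℝ) : ℝ :=
  1 - χ ⬝ᵥ (Z⁻¹ *ᵥ χ)

/-- The points at which the expansion is defined without any division by zero: `Z` is invertible,
and `1 - χᵀZ⁻¹χ` and `1 - υᵀZ⁻¹υ` do not vanish. -/
def IsRegularPoint {n r : ℕ} (x y : Sph n) (z : Fin r → Sph n) : Prop :=
  (gramMat z).det ≠ 0 ∧ schurFactor (gramMat z) (ipVec z x) ≠ 0 ∧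
    schurFactor (gramMat z) (ipVec z y) ≠ 0

/-- The argument `(xᵀy - χᵀZ⁻¹υ) / √((1 - χᵀZ⁻¹χ)(1 - υᵀZ⁻¹υ))` of the Gegenbauer polynomials. -/
noncomputable def expansionArg {n r : ℕ} (x y : Sph n) (z : Fin r → Sph n) : ℝ :=
  (inner ℝ (x : Euc n) (y : Euc n) - ipVec z x ⬝ᵥ ((gramMat z)⁻¹ *ᵥ ipVec z y)) /
    √(schurFactor (gramMat z) (ipVec z x) * schurFactor (gramMat z) (ipVec z y))

/-- The exponent vectors of the monomials of degree at most `d` in `r` variables. -/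
abbrev MonomialIndex (r d : ℕ) : Type :=
  {a : Fin r → Fin (d + 1) // ∑ j, (a j : ℕ) ≤ d}

/-- The vector `m^d(X)` of all monomials of degree at most `d` in the entries of `X`. -/
def monomialVec {r : ℕ} (d : ℕ) (X : Fin r → ℝ) : MonomialIndex r d → ℝ :=
  fun a => ∏ j, X j ^ (a.1 j : ℕ)

/-- The function
`m^d(χ)ᵀ C(Z) m^d(υ) |Z|^i √((1 - χᵀZ⁻¹χ)(1 - υᵀZ⁻¹υ))^i` of `χ`, `υ`, `Z`. -/
noncomputable def shapeCoeff {r : ℕ} (i d : ℕ)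
    (C : Matrix (Fin r) (Fin r) ℝ → Matrix (MonomialIndex r d) (MonomialIndex r d) ℝ)
    (χ υ : Fin r → ℝ) (Z : Matrix (Fin r) (Fin r) ℝ) : ℝ :=
  (monomialVec d χ ⬝ᵥ (C Z *ᵥ monomialVec d υ)) * Z.det ^ i *
    √(schurFactor Z χ * schurFactor Z υ) ^ i

/-- The entries of the matrix function `C` are polynomials in the entries of `Z ∈ 𝒴^r`. -/
def IsPolynomialMatrixOn {r d : ℕ} (Y : Set (Matrix (Fin r) (Fin r) ℝ))
    (C : Matrix (Fin r) (Fin r) ℝ → Matrix (MonomialIndex r d) (MonomialIndex r d) ℝ) : Prop :=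
  ∀ a b, ∃ q : MvPolynomial (Fin r × Fin r) ℝ, ∀ Z ∈ Y,
    C Z a b = MvPolynomial.eval (fun p => Z p.1 p.2) q

/-- `F` is a polynomial in the inner products of the pairs of distinct arguments. -/
def IsPolynomialInInnerProducts {n d : ℕ} (F : (Fin d → Sph n) → ℝ) : Prop :=
  ∃ p : MvPolynomial {e : Fin d × Fin d // e.1 < e.2} ℝ, ∀ v : Fin d → Sph n,
    F v = MvPolynomial.eval (fun e => inner ℝ (v e.1.1 : Euc n) (v e.1.2 : Euc n)) p

/-! At a regular point the Gegenbauer argument is the cosine of the angle between the components of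
`x` and `y` orthogonal to `z_1, …, z_r`, because `xᵀy - χᵀZ⁻¹υ` is the inner product `A` of these
residuals and the two Schur factors are their squared norms. Their product `B` is positive there, so
the powers of `√B` in `c_i` homogenize `P_i`: the `i`-th term is `m(χ)ᵀ C_i(Z) m(υ) (det Z)^i H_i(A,
B)`, with no division by `√B` (`shapeCoeff_mul_eval`).

The residuals live in a space of dimension `n - r = 2α + 2`. There the kernel `H_i(u ⬝ v, |u|²|v|²)`
is PSD (`posSemidef_gegenbauerHom`): zonal polynomials are harmonic, and the Fischer form, under
which `|X|²` is adjoint to the Laplacian, pairs two of them to a nonnegative multiple of this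
kernel. Since `det Z` is nonnegative, the Schur product theorem makes each term PSD.

Regular points are dense because `r + 2 ≤ n`, and each conclusion is a closed condition on a
continuous `F`. Positivity, invariance and polynomiality are thus checked generically and extended
by closure. For polynomiality, the factor `(det Z)^i` is just what clears the denominators of `Z⁻¹`
in `H_i(A, B)`. -/

section Zonal

open MvPolynomial

/-- The homogenized Gegenbauer polynomial `H_i(a, b)`, with `H_i(a, s²) = s ^ i * P_i(a / s)`. -/
noncomputable def gegenbauerHom {R : Type*} [CommRing R] [Algebra ℝ R] (α : ℝ) (a b : R) : ℕ → R
  | 0 => 1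
  | 1 => (2 * α) • a
  | i + 2 => ((i : ℝ) + 2)⁻¹ • ((2 * ((i : ℝ) + 2 + α - 1)) • (a * gegenbauerHom α a b (i + 1)) -
      ((i : ℝ) + 2 + 2 * α - 2) • (b * gegenbauerHom α a b i))

/-! ### Recurrence identities for the homogenized Gegenbauer polynomials. -/

section Algebra

variable {R S : Type*} [CommRing R] [Algebra ℝ R] [CommRing S] [Algebra ℝ S]

theorem gegenbauerHom_succ_succ (α : ℝ) (a b : R) (i : ℕ) :
    ((i : ℝ) + 2) • gegenbauerHom α a b (i + 2) =
      (2 * ((i : ℝ) + 1 + α)) • (a * gegenbauerHom α a b (i + 1)) -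
        ((i : ℝ) + 2 * α) • (b * gegenbauerHom α a b i) := by
  have h : (i : ℝ) + 2 ≠ 0 := by positivity
  rw [gegenbauerHom, smul_inv_smul₀ h]
  congr 2 <;> ring

theorem map_gegenbauerHom (f : R →ₐ[ℝ] S) (α : ℝ) (a b : R) (i : ℕ) :
    f (gegenbauerHom α a b i) = gegenbauerHom α (f a) (f b) i := by
  induction i using Nat.twoStepInduction with
  | zero => simp [gegenbauerHom]
  | one => simp [gegenbauerHom]
  | more i h₀ h₁ => simp [gegenbauerHom, h₀, h₁]

/-- The degenerate order `α = 0` occurs when `n = r + 2`; in this normalization all terms of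
positive degree then vanish. -/
theorem gegenbauerHom_zero_succ (a b : R) (i : ℕ) : gegenbauerHom 0 a b (i + 1) = 0 := by
  induction i using Nat.twoStepInduction with
  | zero => simp [gegenbauerHom]
  | one => simp [gegenbauerHom]
  | more i h₀ h₁ => rw [gegenbauerHom, h₀, h₁]; simp

/-- Setting `b = 0` isolates the leading coefficient. In the zonal case the remainder is a multiple
of `|X|²`, hence Fischer-orthogonal to harmonic polynomials. -/
theorem exists_gegenbauerHom_eq_add_mul (α : ℝ) (a b : R) (i : ℕ) :
    ∃ q : R, gegenbauerHom α a b i = (gegenbauerHom α (1 : ℝ) 0 i) • a ^ i + b * q := by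
  induction i using Nat.twoStepInduction with
  | zero => exact ⟨0, by simp [gegenbauerHom]⟩
  | one => exact ⟨0, by simp [gegenbauerHom]⟩
  | more i h₀ h₁ =>
    obtain ⟨q, hq⟩ := h₁
    refine ⟨((i : ℝ) + 2)⁻¹ • ((2 * ((i : ℝ) + 2 + α - 1)) • (a * q) -
      ((i : ℝ) + 2 + 2 * α - 2) • gegenbauerHom α a b i), ?_⟩
    rw [gegenbauerHom, gegenbauerHom, hq]
    simp only [Algebra.smul_def, map_mul, map_sub, Algebra.algebraMap_self, RingHom.id_apply,
      zero_mul, mul_zero, sub_zero, one_mul]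
    ring

theorem gegenbauerHom_one_zero_pos {α : ℝ} (hα : 0 < α) (i : ℕ) :
    0 < gegenbauerHom α (1 : ℝ) 0 i := by
  induction i using Nat.twoStepInduction with
  | zero => simp [gegenbauerHom]
  | one => simpa [gegenbauerHom]
  | more i h₀ h₁ =>
    rw [gegenbauerHom]
    have h : 0 < (i : ℝ) + 2 + α - 1 := by
      have := Nat.cast_nonneg (α := ℝ) i
      linarith
    simp only [one_mul, zero_mul, smul_eq_mul, mul_zero, sub_zero]
    exact mul_pos (by positivity) (mul_pos (mul_pos two_pos h) h₁)

/-- Differentiating a homogenized Gegenbauer polynomial along a direction lowers the degree. -/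
theorem derivation_gegenbauerHom (D : Derivation ℝ R R) (α β : ℝ) {a q : R}
    (ha : D a = β • (1 : R)) (hq : D q = (2 : ℝ) • a) (i : ℕ) :
    D (gegenbauerHom α a (β • q) (i + 1)) =
      (((i : ℝ) + 2 * α) * β) • gegenbauerHom α a (β • q) i := by
  induction i using Nat.twoStepInduction with
  | zero => simp [gegenbauerHom, ha, smul_smul]
  -- Separate base case: the recurrence for `H_2` involves `H_0`, whose derivative is not of the
  -- form in the induction hypothesis.
  | one =>
    have hr := congrArg D (gegenbauerHom_succ_succ α a (β • q) 0)
    refine smul_right_injective R (two_ne_zero (α := ℝ)) ?_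
    simp only [Nat.cast_zero, zero_add, D.map_smul, map_sub] at hr
    change (2 : ℝ) • D (gegenbauerHom α a (β • q) 2) = _
    rw [hr]
    simp only [gegenbauerHom, D.map_smul, Derivation.leibniz, ha, hq, Derivation.map_one_eq_zero]
    simp only [Algebra.smul_def, Algebra.algebraMap_self, RingHom.id_apply, map_mul, map_add,
      map_ofNat, Nat.cast_one, map_one]
    ring
  | more i h₀ h₁ =>
    have hr := congrArg D (gegenbauerHom_succ_succ α a (β • q) (i + 1))
    have hr' := gegenbauerHom_succ_succ α a (β • q) i
    have h : ((i + 1 : ℕ) : ℝ) + 2 ≠ 0 := by positivity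
    refine smul_right_injective R h ?_
    rw [D.map_smul] at hr
    change (((i + 1 : ℕ) : ℝ) + 2) • D (gegenbauerHom α a (β • q) (i + 1 + 2)) = _
    rw [hr]
    simp only [map_sub, D.map_smul, Derivation.leibniz, ha, hq, h₀, h₁]
    simp only [Algebra.smul_def, map_mul, map_add, map_natCast, map_ofNat, map_one,
      Nat.cast_add, Nat.cast_one, Nat.cast_ofNat] at hr' ⊢
    -- The recurrence one degree lower eliminates the `H_i` term, after which the `a * H_{i+1}`
    -- terms cancel.
    linear_combination (-algebraMap ℝ R β * ((i : R) + 1 + 2 * algebraMap ℝ R α)) * hr'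

end Algebra

/-! ### The Fischer form, harmonic zonal polynomials and positive semidefinite Gegenbauer kernels.
-/

section Fischer

variable {ι : Type*} [Fintype ι]

/-- The Fischer bilinear form on polynomials, for which multiplication by `X j` is adjoint
to `∂_j`. -/
noncomputable def fischerForm : MvPolynomial ι ℝ →ₗ[ℝ] MvPolynomial ι ℝ →ₗ[ℝ] ℝ :=
  (basisMonomials ι ℝ).constr ℝ fun a => (∏ j, ((a j).factorial : ℝ)) • lcoeff ℝ a

theorem fischerForm_monomial (a : ι →₀ ℕ) (c : ℝ) (q : MvPolynomial ι ℝ) :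
    fischerForm (monomial a c) q = c * ((∏ j, ((a j).factorial : ℝ)) * coeff a q) := by
  have h : monomial a c = c • basisMonomials ι ℝ a := by
    rw [coe_basisMonomials, smul_monomial, smul_eq_mul, mul_one]
  rw [h, map_smul, fischerForm, Module.Basis.constr_basis]
  simp

theorem fischerForm_self_nonneg (p : MvPolynomial ι ℝ) : 0 ≤ fischerForm p p := by
  have h : fischerForm p p = ∑ a ∈ p.support, fischerForm (monomial a (coeff a p)) p := by
    rw [← LinearMap.sum_apply, ← map_sum, ← p.as_sum]
  rw [h]
  refine Finset.sum_nonneg fun a _ => ?_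
  rw [fischerForm_monomial]
  have := mul_self_nonneg (coeff a p)
  have h' : (0 : ℝ) ≤ ∏ j, ((a j).factorial : ℝ) := by positivity
  nlinarith [mul_nonneg h' this]

theorem fischerForm_X_mul (j : ι) (p q : MvPolynomial ι ℝ) :
    fischerForm (X j * p) q = fischerForm p (pderiv j q) := by
  classical
  induction p using MvPolynomial.induction_on' with
  | add p p' hp hp' => simp [mul_add, hp, hp']
  | monomial a c =>
    have h : X j * monomial a c = monomial (a + Finsupp.single j 1) c := by
      rw [X, monomial_mul, one_mul, add_comm]
    rw [h, fischerForm_monomial, fischerForm_monomial, coeff_pderiv]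
    have hf : ∏ k, (((a + Finsupp.single j 1 : ι →₀ ℕ) k).factorial : ℝ) =
        (∏ k, ((a k).factorial : ℝ)) * (a j + 1) := by
      rw [← Finset.mul_prod_erase _ _ (Finset.mem_univ j),
        ← Finset.mul_prod_erase _ (fun k => ((a k).factorial : ℝ)) (Finset.mem_univ j)]
      have : ∀ k ∈ Finset.univ.erase j, (((a + Finsupp.single j 1 : ι →₀ ℕ) k).factorial : ℝ) =
          ((a k).factorial : ℝ) := by
        intro k hk
        rw [Finsupp.add_apply, Finsupp.single_eq_of_ne (Finset.ne_of_mem_erase hk), add_zero]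
      rw [Finset.prod_congr rfl this]
      simp [Nat.factorial_succ]
      ring
    rw [hf]
    ring

/-- The linear form with coefficients `y`. -/
noncomputable def linForm (y : ι → ℝ) : MvPolynomial ι ℝ := ∑ j, y j • X j

/-- The directional derivative along `y`. -/
noncomputable def dirDeriv (y : ι → ℝ) :
    Derivation ℝ (MvPolynomial ι ℝ) (MvPolynomial ι ℝ) := ∑ j, y j • pderiv j

variable (ι) in
/-- The squared norm as a polynomial. -/
noncomputable def normSqForm : MvPolynomial ι ℝ := ∑ j, X j ^ 2

/-- The Laplacian on polynomials. -/
noncomputable def polyLaplacian : MvPolynomial ι ℝ →ₗ[ℝ] MvPolynomial ι ℝ :=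
  ∑ j, (pderiv j).toLinearMap ∘ₗ (pderiv j).toLinearMap

theorem dirDeriv_apply (y : ι → ℝ) (p : MvPolynomial ι ℝ) :
    dirDeriv y p = ∑ j, y j • pderiv j p := by
  simp only [dirDeriv, ← Derivation.coeFnAddMonoidHom_apply, map_sum, Finset.sum_apply]
  simp

theorem polyLaplacian_apply (p : MvPolynomial ι ℝ) :
    polyLaplacian p = ∑ j, pderiv j (pderiv j p) := by
  simp [polyLaplacian]

theorem pderiv_linForm (y : ι → ℝ) (j : ι) : pderiv j (linForm y) = C (y j) := by
  classical
  simp [linForm, Pi.single_apply, smul_eq_C_mul]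

theorem pderiv_normSqForm (j : ι) : pderiv j (normSqForm ι) = 2 * X j := by
  classical
  simp [normSqForm, Pi.single_apply]

theorem dirDeriv_linForm (y : ι → ℝ) : dirDeriv y (linForm y) = (y ⬝ᵥ y) • 1 := by
  simp [dirDeriv_apply, pderiv_linForm, dotProduct, smul_eq_C_mul]

theorem dirDeriv_normSqForm (y : ι → ℝ) :
    dirDeriv y (normSqForm ι) = (2 : ℝ) • linForm y := by
  simp only [dirDeriv_apply, pderiv_normSqForm, linForm, Finset.smul_sum, smul_eq_C_mul]
  refine Finset.sum_congr rfl fun j _ => ?_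
  simp only [map_ofNat]
  ring

theorem fischerForm_linForm_mul (y : ι → ℝ) (p q : MvPolynomial ι ℝ) :
    fischerForm (linForm y * p) q = fischerForm p (dirDeriv y q) := by
  simp [linForm, dirDeriv_apply, Finset.sum_mul, fischerForm_X_mul]

theorem fischerForm_normSqForm_mul (p q : MvPolynomial ι ℝ) :
    fischerForm (normSqForm ι * p) q = fischerForm p (polyLaplacian q) := by
  simp [normSqForm, polyLaplacian_apply, Finset.sum_mul, pow_two, mul_assoc, fischerForm_X_mul]

theorem polyLaplacian_linForm_mul (y : ι → ℝ) (p : MvPolynomial ι ℝ) :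
    polyLaplacian (linForm y * p) = linForm y * polyLaplacian p + (2 : ℝ) • dirDeriv y p := by
  simp only [polyLaplacian_apply, dirDeriv_apply, Finset.mul_sum, Finset.smul_sum,
    ← Finset.sum_add_distrib]
  refine Finset.sum_congr rfl fun j _ => ?_
  simp only [pderiv_mul, pderiv_linForm, map_add, pderiv_C, smul_eq_C_mul, map_ofNat]
  ring

theorem polyLaplacian_normSqForm_mul {k : ℕ} {p : MvPolynomial ι ℝ} (hp : p.IsHomogeneous k) :
    polyLaplacian (normSqForm ι * p) =
      normSqForm ι * polyLaplacian p + (4 * (k : ℝ) + 2 * Fintype.card ι) • p := by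
  have h : ((4 * (k : ℝ) + 2 * Fintype.card ι) • p) =
      4 * ∑ j, X j * pderiv j p + ∑ _j : ι, 2 * p := by
    rw [hp.sum_X_mul_pderiv]
    simp only [smul_eq_C_mul, map_add, map_mul, map_ofNat, map_natCast, nsmul_eq_mul,
      Finset.sum_const, Finset.card_univ]
    ring
  rw [h]
  simp only [polyLaplacian_apply, Finset.mul_sum, ← Finset.sum_add_distrib]
  refine Finset.sum_congr rfl fun j _ => ?_
  have h2 : pderiv j (2 : MvPolynomial ι ℝ) = 0 := by
    rw [← map_ofNat (C : ℝ →+* MvPolynomial ι ℝ) 2, pderiv_C]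
  simp only [pderiv_mul, pderiv_normSqForm, map_add, h2, pderiv_X_self]
  ring

/-- Powers of linear forms reproduce point evaluation: each factor moves across as a directional
derivative, which Euler's identity evaluates at `x`. -/
theorem fischerForm_linForm_pow (x : ι → ℝ) {i : ℕ} {q : MvPolynomial ι ℝ}
    (hq : q.IsHomogeneous i) :
    fischerForm (linForm x ^ i) q = i.factorial * eval x q := by
  induction i generalizing q with
  | zero =>
    have hc : q = C (coeff 0 q) := by
      rw [← totalDegree_eq_zero_iff_eq_C]
      exact Nat.le_zero.mp hq.totalDegree_le
    have : (1 : MvPolynomial ι ℝ) = monomial 0 1 := rfl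
    rw [pow_zero, this, fischerForm_monomial, hc]
    simp
  | succ i ih =>
    have hd : (dirDeriv x q).IsHomogeneous i := by
      rw [dirDeriv_apply]
      refine IsHomogeneous.sum _ _ _ fun j _ => ?_
      rw [smul_eq_C_mul]
      simpa using (isHomogeneous_C ι (x j)).mul (hq.pderiv (i := j))
    have he : eval x (dirDeriv x q) = ((i : ℝ) + 1) * eval x q := by
      have := congrArg (eval x) hq.sum_X_mul_pderiv
      simp only [map_sum, map_mul, eval_X, nsmul_eq_mul, Nat.cast_add, Nat.cast_one, map_add,
        map_natCast, map_one] at this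
      rw [← this, dirDeriv_apply]
      simp [smul_eval]
    rw [pow_succ', fischerForm_linForm_mul, ih hd, he, Nat.factorial_succ]
    push_cast
    ring

/-- The zonal polynomial with pole `y`. -/
noncomputable def zonalPoly (α : ℝ) (y : ι → ℝ) (i : ℕ) : MvPolynomial ι ℝ :=
  gegenbauerHom α (linForm y) ((y ⬝ᵥ y) • normSqForm ι) i

omit [Fintype ι] in
theorem isHomogeneous_smul {k : ℕ} {p : MvPolynomial ι ℝ} (c : ℝ) (hp : p.IsHomogeneous k) :
    (c • p).IsHomogeneous k := by
  rw [smul_eq_C_mul]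
  simpa using (isHomogeneous_C ι c).mul hp

theorem isHomogeneous_linForm (y : ι → ℝ) : (linForm y).IsHomogeneous 1 :=
  IsHomogeneous.sum _ _ _ fun j _ => isHomogeneous_smul _ (isHomogeneous_X ℝ j)

theorem isHomogeneous_normSqForm : (normSqForm ι).IsHomogeneous 2 :=
  IsHomogeneous.sum _ _ _ fun j _ => isHomogeneous_X_pow j 2

theorem isHomogeneous_zonalPoly (α : ℝ) (y : ι → ℝ) (i : ℕ) :
    (zonalPoly α y i).IsHomogeneous i := by
  unfold zonalPoly
  induction i using Nat.twoStepInduction with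
  | zero => exact isHomogeneous_one ι ℝ
  | one => exact isHomogeneous_smul _ (isHomogeneous_linForm y)
  | more i h₀ h₁ =>
    rw [gegenbauerHom]
    refine isHomogeneous_smul _ (IsHomogeneous.sub (isHomogeneous_smul _ ?_)
      (isHomogeneous_smul _ ?_))
    · convert (isHomogeneous_linForm y).mul h₁ using 1
      ring
    · convert (isHomogeneous_smul (y ⬝ᵥ y) isHomogeneous_normSqForm).mul h₀ using 1
      ring

theorem eval_zonalPoly (α : ℝ) (x y : ι → ℝ) (i : ℕ) :
    eval x (zonalPoly α y i) = gegenbauerHom α (x ⬝ᵥ y) ((x ⬝ᵥ x) * (y ⬝ᵥ y)) i := by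
  have h := map_gegenbauerHom (aeval x : MvPolynomial ι ℝ →ₐ[ℝ] ℝ) α (linForm y)
    ((y ⬝ᵥ y) • normSqForm ι) i
  simp only [aeval_eq_eval] at h
  rw [zonalPoly, h]
  congr 1
  · simp [linForm, dotProduct, mul_comm]
  · simp [normSqForm, dotProduct, pow_two, mul_comm]

/-- Applying the Laplacian to the recurrence leaves only multiples of the degree `i` zonal
polynomial, and the relation between dimension and `α` makes their coefficients cancel. -/
theorem polyLaplacian_zonalPoly {α : ℝ} (hα : (Fintype.card ι : ℝ) = 2 * α + 2) (y : ι → ℝ)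
    (i : ℕ) : polyLaplacian (zonalPoly α y i) = 0 := by
  induction i using Nat.twoStepInduction with
  | zero => simp [zonalPoly, gegenbauerHom, polyLaplacian_apply]
  | one => simp [zonalPoly, gegenbauerHom, polyLaplacian_apply, pderiv_linForm]
  | more i h₀ h₁ =>
    have hr := congrArg polyLaplacian
      (gegenbauerHom_succ_succ α (linForm y) ((y ⬝ᵥ y) • normSqForm ι) i)
    have hd := derivation_gegenbauerHom (dirDeriv y) α _ (dirDeriv_linForm y)
      (dirDeriv_normSqForm y) i
    have h : (i : ℝ) + 2 ≠ 0 := by positivity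
    refine smul_right_injective _ h ?_
    change ((i : ℝ) + 2) • polyLaplacian _ = ((i : ℝ) + 2) • 0
    simp only [← zonalPoly.eq_def] at hr hd
    rw [← map_smul, hr, map_sub, map_smul, map_smul, polyLaplacian_linForm_mul, smul_mul_assoc,
      map_smul, polyLaplacian_normSqForm_mul (isHomogeneous_zonalPoly α y i), h₀, h₁, hd, hα]
    simp only [mul_zero, zero_add, smul_zero, smul_smul, ← sub_smul]
    convert zero_smul ℝ _ using 2
    ring

/-- Modulo `|X|²` the left zonal polynomial is a multiple of a power of a linear form, which
evaluates the right one at `x`; the `|X|²` part pairs to zero by harmonicity. -/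
theorem fischerForm_zonalPoly {α : ℝ} (hα : (Fintype.card ι : ℝ) = 2 * α + 2) (x y : ι → ℝ)
    (i : ℕ) : fischerForm (zonalPoly α x i) (zonalPoly α y i) =
      gegenbauerHom α (1 : ℝ) 0 i * i.factorial *
        gegenbauerHom α (x ⬝ᵥ y) ((x ⬝ᵥ x) * (y ⬝ᵥ y)) i := by
  obtain ⟨q, hq⟩ := exists_gegenbauerHom_eq_add_mul α (linForm x) ((x ⬝ᵥ x) • normSqForm ι) i
  have hx : zonalPoly α x i = _ := hq
  rw [hx, map_add, LinearMap.add_apply, smul_mul_assoc, map_smul, map_smul, LinearMap.smul_apply,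
    LinearMap.smul_apply, fischerForm_normSqForm_mul, polyLaplacian_zonalPoly hα,
    fischerForm_linForm_pow x (isHomogeneous_zonalPoly α y i), eval_zonalPoly]
  simp [mul_assoc]

/-- Zonal Gegenbauer kernels are positive semidefinite. -/
theorem posSemidef_gegenbauerHom {κ : Type*} [Fintype κ] {α : ℝ} (hα₀ : 0 ≤ α)
    (hα : (Fintype.card ι : ℝ) = 2 * α + 2) (v : κ → ι → ℝ) (i : ℕ) :
    (Matrix.of fun s t => gegenbauerHom α (v s ⬝ᵥ v t)
      ((v s ⬝ᵥ v s) * (v t ⬝ᵥ v t)) i).PosSemidef := by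
  rw [Matrix.posSemidef_iff_dotProduct_mulVec]
  refine ⟨Matrix.IsHermitian.ext fun s t => ?_, fun w => ?_⟩
  · simp [dotProduct_comm (v s) (v t), mul_comm (v s ⬝ᵥ v s)]
  -- Once the constant is positive, the quadratic form is, up to that constant, the Fischer square
  -- of a combination of zonal polynomials.
  have key (c : ℝ) (hc : 0 < c) (hc' : ∀ x y : ι → ℝ,
      fischerForm (zonalPoly α x i) (zonalPoly α y i) =
        c * gegenbauerHom α (x ⬝ᵥ y) ((x ⬝ᵥ x) * (y ⬝ᵥ y)) i) :
      0 ≤ star w ⬝ᵥ ((Matrix.of fun s t => gegenbauerHom α (v s ⬝ᵥ v t)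
        ((v s ⬝ᵥ v s) * (v t ⬝ᵥ v t)) i) *ᵥ w) := by
    have h := fischerForm_self_nonneg (∑ s, w s • zonalPoly α (v s) i)
    refine nonneg_of_mul_nonneg_right (a := c) (h.trans_eq ?_) hc
    simp only [map_sum, LinearMap.sum_apply, map_smul, LinearMap.smul_apply, hc', smul_eq_mul,
      dotProduct, Matrix.mulVec, Finset.mul_sum, Matrix.of_apply, star_trivial]
    rw [Finset.sum_comm]
    exact Finset.sum_congr rfl fun s _ => Finset.sum_congr rfl fun t _ => by ring
  -- At `α = 0` the leading coefficient vanishes for `i > 0`, so it cannot be divided out, but then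
  -- the kernel itself is zero.
  rcases hα₀.eq_or_lt with rfl | hα₁
  · cases i with
    | zero =>
      refine key 1 one_pos fun x y => ?_
      rw [fischerForm_zonalPoly hα]
      simp [gegenbauerHom]
    | succ i => simp [gegenbauerHom_zero_succ, dotProduct, Matrix.mulVec]
  · exact key _ (mul_pos (gegenbauerHom_one_zero_pos hα₁ i) (by positivity))
      fun x y => fischerForm_zonalPoly hα x y i

end Fischer

end Zonal

theorem gegenbauerHom_sq (α a : ℝ) {s : ℝ} (hs : s ≠ 0) (i : ℕ) :
    gegenbauerHom α a (s ^ 2) i = s ^ i * (gegenbauer α i).eval (a / s) := by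
  induction i using Nat.twoStepInduction with
  | zero => simp [gegenbauerHom, gegenbauer]
  | one =>
    simp [gegenbauerHom, gegenbauer]
    field_simp
  | more i h₀ h₁ =>
    simp only [gegenbauerHom, gegenbauer, h₀, h₁, Polynomial.eval_mul, Polynomial.eval_sub,
      Polynomial.eval_C, Polynomial.eval_X, smul_eq_mul]
    push_cast
    field_simp
    ring

/-- With `t = det Z`, this absorbs `(det Z)^i` into the arguments and turns them into polynomials.
-/
theorem gegenbauerHom_mul_sq {R : Type*} [CommRing R] [Algebra ℝ R] (α : ℝ) (t a b : R) (i : ℕ) :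
    gegenbauerHom α (t * a) (t ^ 2 * b) i = t ^ i * gegenbauerHom α a b i := by
  induction i using Nat.twoStepInduction with
  | zero => simp [gegenbauerHom]
  | one => simp [gegenbauerHom]
  | more i h₀ h₁ =>
    simp only [gegenbauerHom, h₀, h₁, Algebra.smul_def]
    ring

/-! ### Residuals orthogonal to `z`, and density of generic configurations. -/

section Geometry

variable {n r : ℕ}

theorem det_gramMat_ne_zero_iff (z : Fin r → Sph n) :
    (gramMat z).det ≠ 0 ↔ LinearIndependent ℝ fun j => (z j : Euc n) :=
  Matrix.det_gram_ne_zero_iff_linearIndependent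

theorem det_gramMat_nonneg (z : Fin r → Sph n) : 0 ≤ (gramMat z).det :=
  (Matrix.posSemidef_gram ℝ fun j => (z j : Euc n)).det_nonneg

/-- The inner product of the components of `x` and `y` orthogonal to `z_1, …, z_r`. -/
noncomputable def residualInner (x y : Sph n) (z : Fin r → Sph n) : ℝ :=
  inner ℝ (x : Euc n) (y : Euc n) - ipVec z x ⬝ᵥ ((gramMat z)⁻¹ *ᵥ ipVec z y)

/-- The component of `y` orthogonal to `z_1, …, z_r`. -/
noncomputable def orthResidual (z : Fin r → Sph n) (y : Sph n) : Euc n :=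
  (y : Euc n) - ∑ j, ((gramMat z)⁻¹ *ᵥ ipVec z y) j • (z j : Euc n)

theorem inner_residual (x y : Sph n) (z : Fin r → Sph n) :
    inner ℝ (x : Euc n) (orthResidual z y) = residualInner x y z := by
  simp only [orthResidual, residualInner, inner_sub_right, inner_sum, inner_smul_right, dotProduct,
    ipVec]
  congr 1
  exact Finset.sum_congr rfl fun j _ => by rw [mul_comm, real_inner_comm]

theorem inner_residual_right {z : Fin r → Sph n} (hz : (gramMat z).det ≠ 0) (y : Sph n)
    (k : Fin r) : inner ℝ (z k : Euc n) (orthResidual z y) = 0 := by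
  have h : (gramMat z *ᵥ ((gramMat z)⁻¹ *ᵥ ipVec z y)) k = ipVec z y k := by
    rw [Matrix.mulVec_mulVec, Matrix.mul_nonsing_inv _ (isUnit_iff_ne_zero.mpr hz),
      Matrix.one_mulVec]
  simp only [orthResidual, inner_sub_right, inner_sum, inner_smul_right]
  rw [sub_eq_zero]
  change ipVec z y k = _
  rw [← h, Matrix.mulVec, dotProduct]
  exact Finset.sum_congr rfl fun j _ => mul_comm _ _

theorem residual_mem_orthogonal {z : Fin r → Sph n} (hz : (gramMat z).det ≠ 0) (y : Sph n) :
    orthResidual z y ∈ (Submodule.span ℝ (Set.range fun j => (z j : Euc n)))ᗮ := by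
  rw [Submodule.mem_orthogonal]
  intro u hu
  induction hu using Submodule.span_induction with
  | mem u hu => obtain ⟨k, rfl⟩ := hu; exact inner_residual_right hz y k
  | zero => simp
  | add u v _ _ hu hv => rw [inner_add_left, hu, hv, add_zero]
  | smul c u _ hu => rw [inner_smul_left, hu, mul_zero]

theorem sub_residual_mem_span (z : Fin r → Sph n) (y : Sph n) :
    (y : Euc n) - orthResidual z y ∈ Submodule.span ℝ (Set.range fun j => (z j : Euc n)) := by
  rw [orthResidual, sub_sub_cancel]
  exact Submodule.sum_mem _ fun j _ => Submodule.smul_mem _ _ (Submodule.subset_span ⟨j, rfl⟩)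

theorem inner_residual_residual {z : Fin r → Sph n} (hz : (gramMat z).det ≠ 0) (x y : Sph n) :
    inner ℝ (orthResidual z x) (orthResidual z y) = residualInner x y z := by
  have h := (Submodule.mem_orthogonal _ _).mp (residual_mem_orthogonal hz y) _
    (sub_residual_mem_span z x)
  rw [inner_sub_left, sub_eq_zero] at h
  rw [← h, inner_residual]

theorem schurFactor_eq_residualInner (x : Sph n) (z : Fin r → Sph n) :
    schurFactor (gramMat z) (ipVec z x) = residualInner x x z := by
  have : inner ℝ (x : Euc n) (x : Euc n) = 1 := by
    rw [real_inner_self_eq_norm_sq, norm_eq_of_mem_sphere, one_pow]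
  rw [schurFactor, residualInner, this]

theorem residualInner_self_nonneg {z : Fin r → Sph n} (hz : (gramMat z).det ≠ 0) (x : Sph n) :
    0 ≤ residualInner x x z := by
  rw [← inner_residual_residual hz]
  exact real_inner_self_nonneg

theorem residualInner_self_ne_zero {z : Fin r → Sph n} (hz : (gramMat z).det ≠ 0) {x : Sph n}
    (hx : (x : Euc n) ∉ Submodule.span ℝ (Set.range fun j => (z j : Euc n))) :
    residualInner x x z ≠ 0 := by
  rw [← inner_residual_residual hz, inner_self_ne_zero]
  intro h
  apply hx
  simpa [h] using sub_residual_mem_span z x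

theorem isRegularPoint_of_notMem_span {z : Fin r → Sph n} (hz : (gramMat z).det ≠ 0) {x y : Sph n}
    (hx : (x : Euc n) ∉ Submodule.span ℝ (Set.range fun j => (z j : Euc n)))
    (hy : (y : Euc n) ∉ Submodule.span ℝ (Set.range fun j => (z j : Euc n))) :
    IsRegularPoint x y z := by
  refine ⟨hz, ?_, ?_⟩ <;> rw [schurFactor_eq_residualInner] <;>
    exact residualInner_self_ne_zero hz ‹_›

/-- Coordinates in the orthogonal complement of the span of `z_1, …, z_r`. -/
theorem exists_residual_coordinates {z : Fin r → Sph n} (hz : (gramMat z).det ≠ 0) :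
    ∃ v : Sph n → Fin (n - r) → ℝ, ∀ x y, v x ⬝ᵥ v y = residualInner x y z := by
  set W := Submodule.span ℝ (Set.range fun j => (z j : Euc n)) with hW
  have hfin : Module.finrank ℝ W = r := by
    rw [hW, finrank_span_eq_card ((det_gramMat_ne_zero_iff z).mp hz), Fintype.card_fin]
  have hfin' : Module.finrank ℝ Wᗮ = n - r := by
    have := W.finrank_add_finrank_orthogonal
    rw [finrank_euclideanSpace_fin] at this
    omega
  let b := (stdOrthonormalBasis ℝ Wᗮ).reindex (finCongr hfin')
  refine ⟨fun x => b.repr ⟨orthResidual z x, residual_mem_orthogonal hz x⟩, fun x y => ?_⟩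
  rw [← inner_residual_residual hz]
  have := b.repr.inner_map_map ⟨orthResidual z x, residual_mem_orthogonal hz x⟩
    ⟨orthResidual z y, residual_mem_orthogonal hz y⟩
  rw [Submodule.coe_inner] at this
  rw [← this, EuclideanSpace.inner_eq_star_dotProduct, star_trivial, dotProduct_comm]

/-- The points of the sphere outside a proper subspace are dense. -/
theorem dense_sphere_notMem {W : Submodule ℝ (Euc n)} (hW : W ≠ ⊤) :
    Dense {x : Sph n | (x : Euc n) ∉ W} := by
  intro x
  rw [Metric.mem_closure_iff]
  intro ε hε
  let f : Euc n → Euc n := fun v => ‖v‖⁻¹ • v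
  have hx₁ : ‖(x : Euc n)‖ = 1 := norm_eq_of_mem_sphere x
  have hx₀ : (x : Euc n) ≠ 0 := by
    rw [← norm_ne_zero_iff, hx₁]
    exact one_ne_zero
  have hfx : f x = x := by simp [f, hx₁]
  have hf : ContinuousAt f x :=
    (continuousAt_id.norm.inv₀ (norm_ne_zero_iff.mpr hx₀)).smul continuousAt_id
  -- This is a neighbourhood in the ambient space, so a proper subspace, having empty interior,
  -- cannot contain it; a point outside is then normalized.
  have hU : {v : Euc n | dist (f v) x < ε ∧ v ≠ 0} ∈ nhds (x : Euc n) := by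
    refine Filter.inter_mem ?_ (isOpen_ne.mem_nhds hx₀)
    have := hf (Metric.ball_mem_nhds (f x) hε)
    rwa [hfx] at this
  obtain ⟨v, ⟨hv, hv₀⟩, hvW⟩ : ∃ v : Euc n, (dist (f v) x < ε ∧ v ≠ 0) ∧ v ∉ W := by
    by_contra! h
    exact hW (W.eq_top_of_nonempty_interior' ⟨x, mem_interior_iff_mem_nhds.mpr
      (Filter.mem_of_superset hU fun v hv => h v hv)⟩)
  have hv' : ‖v‖ ≠ 0 := norm_ne_zero_iff.mpr hv₀
  refine ⟨⟨f v, ?_⟩, fun h => hvW ?_, ?_⟩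
  · simp [f, norm_smul, hv']
  · have : v = ‖v‖ • f v := by simp [f, smul_smul, hv']
    rw [this]
    exact W.smul_mem _ h
  · rw [dist_comm]
    exact hv

theorem span_range_ne_top {k : ℕ} (hk : k < n) (z : Fin k → Euc n) :
    Submodule.span ℝ (Set.range z) ≠ ⊤ := by
  intro h
  have h' := finrank_range_le_card (R := ℝ) z
  rw [Set.finrank, h, finrank_top, finrank_euclideanSpace_fin, Fintype.card_fin] at h'
  omega

theorem exists_linearIndependent_dist_lt {k : ℕ} (hk : k ≤ n) (z : Fin k → Sph n) {ε : ℝ}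
    (hε : 0 < ε) : ∃ z' : Fin k → Sph n, (∀ j, dist (z j) (z' j) < ε) ∧
      LinearIndependent ℝ fun j => (z' j : Euc n) := by
  induction k with
  | zero => exact ⟨z, fun j => j.elim0, linearIndependent_empty_type⟩
  | succ k ih =>
    obtain ⟨z', hz', hli⟩ := ih (by omega) (Fin.tail z)
    obtain ⟨x, hx, hd⟩ := Metric.mem_closure_iff.mp
      (dense_sphere_notMem (span_range_ne_top (by omega) fun j => (z' j : Euc n)) (z 0)) ε hε
    refine ⟨Fin.cons x z', Fin.cases hd hz', ?_⟩
    have h : (fun j => ((Fin.cons x z' : Fin (k + 1) → Sph n) j : Euc n)) =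
        Fin.cons (x : Euc n) fun j => (z' j : Euc n) := by
      funext j
      refine Fin.cases rfl (fun _ => rfl) j
    rw [h, linearIndependent_finCons]
    exact ⟨hli, hx⟩

theorem dense_linearIndependent {k : ℕ} (hk : k ≤ n) :
    Dense {z : Fin k → Sph n | LinearIndependent ℝ fun j => (z j : Euc n)} := by
  intro z
  rw [Metric.mem_closure_iff]
  intro ε hε
  obtain ⟨z', hz', hli⟩ := exists_linearIndependent_dist_lt hk z hε
  exact ⟨z', hli, (dist_pi_lt_iff hε).mpr hz'⟩

theorem isRegularPoint_of_linearIndependent {v : Fin (r + 2) → Sph n}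
    (hv : LinearIndependent ℝ fun j => (v j : Euc n)) :
    IsRegularPoint (v 0) (v 1) fun j => v j.succ.succ := by
  have hr : (Set.range fun j : Fin r => (v j.succ.succ : Euc n)) =
      (fun j => (v j : Euc n)) '' Set.range fun j : Fin r => j.succ.succ := by
    rw [← Set.range_comp]
    rfl
  refine isRegularPoint_of_notMem_span ((det_gramMat_ne_zero_iff _).mpr
    (hv.comp (fun j : Fin r => j.succ.succ)
      ((Fin.succ_injective _).comp (Fin.succ_injective _)))) ?_ ?_
  · rw [hr]
    refine hv.notMem_span_image ?_
    rintro ⟨j, hj⟩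
    exact Fin.succ_ne_zero _ hj
  · rw [hr]
    refine hv.notMem_span_image ?_
    rintro ⟨j, hj⟩
    exact Fin.succ_ne_zero _ (Fin.succ_injective _ (hj.trans Fin.succ_zero_eq_one.symm))

theorem tuple_eta {W : Type*} (v : Fin (r + 2) → W) :
    tuple (v 0) (v 1) (fun j => v j.succ.succ) = v := by
  funext j
  refine Fin.cases rfl (fun j => Fin.cases rfl (fun _ => rfl) j) j

end Geometry

/-! ### Positive semidefiniteness of the terms and its passage to the closure. -/

theorem continuous_tuple {T W : Type*} [TopologicalSpace T] [TopologicalSpace W] {r : ℕ}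
    {x y : T → W} {z : T → Fin r → W} (hx : Continuous x) (hy : Continuous y)
    (hz : Continuous z) : Continuous fun t => tuple (x t) (y t) (z t) := by
  refine continuous_pi fun j => ?_
  refine Fin.cases hx (fun j => Fin.cases hy (fun j => ?_) j) j
  exact (continuous_apply j).comp hz

theorem isClosed_setOf_posSemidef {T κ : Type*} [TopologicalSpace T] [Fintype κ]
    {M : T → Matrix κ κ ℝ} (hM : Continuous M) : IsClosed {t | (M t).PosSemidef} := by
  simp only [Matrix.posSemidef_iff_dotProduct_mulVec, Set.ofPred_and, Set.ofPred_forall]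
  refine IsClosed.inter (isClosed_eq hM.matrix_conjTranspose hM)
    (isClosed_iInter fun w => isClosed_le continuous_const ?_)
  exact continuous_const.dotProduct (hM.matrix_mulVec continuous_const)

/-- The `i`-th term of the expansion, written without division by `√(BD)`, where `B`, `D` and
`A` are the two Schur factors and the numerator of the argument. -/
noncomputable def expansionTerm {r : ℕ} (α : ℝ) (i d : ℕ)
    (M : Matrix (MonomialIndex r d) (MonomialIndex r d) ℝ) (χ υ : Fin r → ℝ) (δ A B : ℝ) : ℝ :=
  (monomialVec d χ ⬝ᵥ (M *ᵥ monomialVec d υ)) * (δ ^ i * gegenbauerHom α A B i)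

theorem shapeCoeff_mul_eval {n r i d : ℕ}
    (C : Matrix (Fin r) (Fin r) ℝ → Matrix (MonomialIndex r d) (MonomialIndex r d) ℝ) (α : ℝ)
    {x y : Sph n} {z : Fin r → Sph n} (h : IsRegularPoint x y z) :
    shapeCoeff i d C (ipVec z x) (ipVec z y) (gramMat z) *
        (gegenbauer α i).eval (expansionArg x y z) =
      expansionTerm α i d (C (gramMat z)) (ipVec z x) (ipVec z y) (gramMat z).det
        (residualInner x y z)
        (schurFactor (gramMat z) (ipVec z x) * schurFactor (gramMat z) (ipVec z y)) := by
  obtain ⟨hz, hx, hy⟩ := h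
  have hx' := residualInner_self_nonneg hz x
  have hy' := residualInner_self_nonneg hz y
  rw [← schurFactor_eq_residualInner] at hx' hy'
  have hpos := mul_pos (hx'.lt_of_ne' hx) (hy'.lt_of_ne' hy)
  have hg := gegenbauerHom_sq α (residualInner x y z) (Real.sqrt_pos.mpr hpos).ne' i
  rw [Real.sq_sqrt hpos.le] at hg
  rw [expansionTerm, hg, shapeCoeff, expansionArg, residualInner]
  ring

/-- A Schur product: a congruence transform of `M` times the Gegenbauer kernel of the residuals,
scaled by the nonnegative `(det Z)^i`. -/
theorem posSemidef_expansionTerm {n r i d : ℕ} {κ : Type*} [Fintype κ] (hn : r + 2 ≤ n)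
    {M : Matrix (MonomialIndex r d) (MonomialIndex r d) ℝ} (hM : M.PosSemidef)
    {z : Fin r → Sph n} (hz : (gramMat z).det ≠ 0) (x : κ → Sph n) :
    (Matrix.of fun s t => expansionTerm (((n : ℝ) - r) / 2 - 1) i d M (ipVec z (x s))
      (ipVec z (x t)) (gramMat z).det (residualInner (x s) (x t) z)
      (schurFactor (gramMat z) (ipVec z (x s)) *
        schurFactor (gramMat z) (ipVec z (x t)))).PosSemidef := by
  obtain ⟨v, hv⟩ := exists_residual_coordinates hz
  have hn' : (r : ℝ) + 2 ≤ n := by exact_mod_cast hn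
  have hg := posSemidef_gegenbauerHom (α := ((n : ℝ) - r) / 2 - 1) (by linarith)
    (by rw [Fintype.card_fin, Nat.cast_sub (by omega)]; ring) (fun s => v (x s)) i
  have hm : (Matrix.of fun s t => monomialVec d (ipVec z (x s)) ⬝ᵥ
      (M *ᵥ monomialVec d (ipVec z (x t)))).PosSemidef := by
    convert hM.mul_mul_conjTranspose_same
      (Matrix.of fun s => monomialVec d (ipVec z (x s))) using 1
    ext s t
    simp only [Matrix.of_apply, Matrix.mul_apply, Matrix.conjTranspose_apply, star_trivial,
      dotProduct, Matrix.mulVec, Finset.mul_sum, Finset.sum_mul]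
    rw [Finset.sum_comm]
    simp only [mul_assoc]
  refine Eq.mp (congrArg Matrix.PosSemidef ?_)
    (hm.hadamard (hg.smul (pow_nonneg (det_gramMat_nonneg z) i)))
  ext s t
  simp [expansionTerm, hv, schurFactor_eq_residualInner]

theorem expansion_eq_sum {n r N : ℕ} {F : (Fin (r + 2) → Sph n) → ℝ}
    {c : ℕ → (Fin r → ℝ) → (Fin r → ℝ) → Matrix (Fin r) (Fin r) ℝ → ℝ} {d : ℕ → ℕ}
    {C : (i : ℕ) → Matrix (Fin r) (Fin r) ℝ →
      Matrix (MonomialIndex r (d i)) (MonomialIndex r (d i)) ℝ} {α : ℝ}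
    {x y : Sph n} {z : Fin r → Sph n} (h : IsRegularPoint x y z)
    (hshape : ∀ i ≤ N, c i (ipVec z x) (ipVec z y) (gramMat z) =
        shapeCoeff i (d i) (C i) (ipVec z x) (ipVec z y) (gramMat z))
    (hzero : ∀ i, N < i → c i (ipVec z x) (ipVec z y) (gramMat z) = 0)
    (hF : HasSum (fun i => c i (ipVec z x) (ipVec z y) (gramMat z) *
          (gegenbauer α i).eval (expansionArg x y z)) (F (tuple x y z))) :
    F (tuple x y z) = ∑ i ∈ Finset.range (N + 1),
      expansionTerm α i (d i) (C i (gramMat z)) (ipVec z x) (ipVec z y) (gramMat z).det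
        (residualInner x y z)
        (schurFactor (gramMat z) (ipVec z x) * schurFactor (gramMat z) (ipVec z y)) := by
  refine (hF.unique (hasSum_sum_of_ne_finset_zero fun i hi => ?_)).trans
    (Finset.sum_congr rfl fun i hi => ?_)
  · rw [hzero i (by simpa using hi), zero_mul]
  · rw [hshape i (Nat.lt_succ_iff.mp (Finset.mem_range.mp hi)), shapeCoeff_mul_eval _ _ h]

/-- A continuous tensor that is positive semidefinite at generic points is so everywhere. -/
theorem posSemidef_of_generic {n r : ℕ} {κ : Type*} [Fintype κ] (hn : r < n)
    {F : (Fin (r + 2) → Sph n) → ℝ} (hF : Continuous F)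
    (h : ∀ (z : Fin r → Sph n) (x : κ → Sph n), (∀ s t, IsRegularPoint (x s) (x t) z) →
      (gramMat z).det ≠ 0 → (Matrix.of fun s t => F (tuple (x s) (x t) z)).PosSemidef)
    (z : Fin r → Sph n) (x : κ → Sph n) :
    (Matrix.of fun s t => F (tuple (x s) (x t) z)).PosSemidef := by
  -- Closure is taken in two stages, first in `x` with `z` fixed, then in `z`. The family `x` may be
  -- too large to be independent, but each member only has to avoid the span of `z`.
  have hz : ∀ z : Fin r → Sph n, (LinearIndependent ℝ fun j => (z j : Euc n)) →
      ∀ x : κ → Sph n, (Matrix.of fun s t => F (tuple (x s) (x t) z)).PosSemidef := by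
    intro z hli x
    have hdet := (det_gramMat_ne_zero_iff z).mpr hli
    have hd := dense_pi Set.univ fun (_ : κ) _ =>
      dense_sphere_notMem (span_range_ne_top hn fun j => (z j : Euc n))
    have hc : IsClosed {x : κ → Sph n |
        (Matrix.of fun s t => F (tuple (x s) (x t) z)).PosSemidef} :=
      isClosed_setOf_posSemidef (continuous_matrix fun s t => hF.comp
        (continuous_tuple (continuous_apply s) (continuous_apply t) continuous_const))
    refine closure_minimal ?_ hc (hd x)
    intro x hx
    simp only [Set.mem_pi, Set.mem_univ, true_imp_iff] at hx
    exact h z x (fun s t => isRegularPoint_of_notMem_span hdet (hx s) (hx t)) hdet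
  have hc : IsClosed {z : Fin r → Sph n |
      (Matrix.of fun s t => F (tuple (x s) (x t) z)).PosSemidef} :=
    isClosed_setOf_posSemidef (continuous_matrix fun s t => hF.comp
      (continuous_tuple continuous_const continuous_const continuous_id))
  exact closure_minimal (fun z hli => hz z hli x) hc (dense_linearIndependent hn.le z)

theorem is2PSD_of_posSemidef.{u} {V : Type u} [TopologicalSpace V] {r : ℕ}
    {F : (Fin (r + 2) → V) → ℝ} (hF : Continuous F)
    (h : ∀ (κ : Type u) [Fintype κ] (z : Fin r → V) (x : κ → V),
      (Matrix.of fun s t => F (tuple (x s) (x t) z)).PosSemidef) : Is2PSD F := by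
  refine ⟨hF, fun z => ⟨hF.comp (continuous_tuple continuous_fst continuous_snd continuous_const),
    fun x y => ?_, fun U => h U z fun s => s⟩⟩
  -- Symmetry of the kernel is the Hermitian part of positivity for the two-point family `x, y`.
  have := (h (ULift Bool) z fun s => cond s.down x y).1.apply ⟨false⟩ ⟨true⟩
  simpa using this

/-! ### Orthogonal invariance. -/

section Invariance

variable {n r : ℕ}

theorem inner_sphereRotate (g : Euc n ≃ₗᵢ[ℝ] Euc n) (x y : Sph n) :
    inner ℝ (sphereRotate g x : Euc n) (sphereRotate g y : Euc n) =
      inner ℝ (x : Euc n) (y : Euc n) :=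
  g.inner_map_map _ _

theorem gramMat_sphereRotate (g : Euc n ≃ₗᵢ[ℝ] Euc n) (z : Fin r → Sph n) :
    gramMat (fun j => sphereRotate g (z j)) = gramMat z := by
  ext j k
  exact inner_sphereRotate g _ _

theorem ipVec_sphereRotate (g : Euc n ≃ₗᵢ[ℝ] Euc n) (z : Fin r → Sph n) (x : Sph n) :
    ipVec (fun j => sphereRotate g (z j)) (sphereRotate g x) = ipVec z x := by
  ext j
  exact inner_sphereRotate g _ _

theorem isRegularPoint_sphereRotate (g : Euc n ≃ₗᵢ[ℝ] Euc n) {x y : Sph n} {z : Fin r → Sph n}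
    (h : IsRegularPoint x y z) : IsRegularPoint (sphereRotate g x) (sphereRotate g y)
      (fun j => sphereRotate g (z j)) := by
  simpa only [IsRegularPoint, gramMat_sphereRotate, ipVec_sphereRotate] using h

theorem expansionArg_sphereRotate (g : Euc n ≃ₗᵢ[ℝ] Euc n) (x y : Sph n) (z : Fin r → Sph n) :
    expansionArg (sphereRotate g x) (sphereRotate g y) (fun j => sphereRotate g (z j)) =
      expansionArg x y z := by
  simp only [expansionArg, gramMat_sphereRotate, ipVec_sphereRotate, inner_sphereRotate]

theorem continuous_sphereRotate (g : Euc n ≃ₗᵢ[ℝ] Euc n) : Continuous (sphereRotate g) :=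
  (g.continuous.comp continuous_subtype_val).subtype_mk _

/-- A continuous function given on regular points by a function of inner products is invariant. -/
theorem isOrthogonalInvariant_of_regular (hn : r + 2 ≤ n) {F : (Fin (r + 2) → Sph n) → ℝ}
    (hF : Continuous F) (h : ∀ (g : Euc n ≃ₗᵢ[ℝ] Euc n) (x y : Sph n) (z : Fin r → Sph n),
      IsRegularPoint x y z → F (tuple (sphereRotate g x) (sphereRotate g y)
        fun j => sphereRotate g (z j)) = F (tuple x y z)) : IsOrthogonalInvariant F := by
  intro g v
  have hc : IsClosed {v : Fin (r + 2) → Sph n | F (fun j => sphereRotate g (v j)) = F v} :=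
    isClosed_eq (hF.comp (continuous_pi fun j =>
      (continuous_sphereRotate g).comp (continuous_apply j))) hF
  refine closure_minimal (fun v hv => ?_) hc (dense_linearIndependent hn v)
  have := h g _ _ _ (isRegularPoint_of_linearIndependent hv)
  rwa [tuple_eta v, tuple_eta fun j => sphereRotate g (v j)] at this

end Invariance

/-! ### Polynomiality in the inner products. -/

section Polynomiality

open MvPolynomial

variable {n r : ℕ}

/-- The polynomial whose value is the inner product of the `j`-th and `k`-th arguments. -/
noncomputable def innerPoly {m : ℕ} (j k : Fin m) :
    MvPolynomial {e : Fin m × Fin m // e.1 < e.2} ℝ :=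
  -- Diagonal inner products are not variables; they equal 1 on the sphere.
  if h : j < k then X ⟨(j, k), h⟩ else if h : k < j then X ⟨(k, j), h⟩ else 1

theorem eval_innerPoly {m : ℕ} (v : Fin m → Sph n) (j k : Fin m) :
    eval (fun e : {e : Fin m × Fin m // e.1 < e.2} =>
      inner ℝ (v e.1.1 : Euc n) (v e.1.2 : Euc n)) (innerPoly j k) =
      inner ℝ (v j : Euc n) (v k : Euc n) := by
  rcases lt_trichotomy j k with h | rfl | h
  · simp [innerPoly, h]
  · simp [innerPoly]
  · simp [innerPoly, h, h.not_gt, real_inner_comm]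

variable (r) in
/-- The Gram matrix of `z` as a polynomial matrix in the inner products. -/
noncomputable def gramPoly :
    Matrix (Fin r) (Fin r) (MvPolynomial {e : Fin (r + 2) × Fin (r + 2) // e.1 < e.2} ℝ) :=
  Matrix.of fun j k => innerPoly j.succ.succ k.succ.succ

/-- The inner products with `z` of the `l`-th argument as a polynomial vector. -/
noncomputable def ipPoly (l : Fin (r + 2)) :
    Fin r → MvPolynomial {e : Fin (r + 2) × Fin (r + 2) // e.1 < e.2} ℝ :=
  fun j => innerPoly j.succ.succ l

/-- The polynomial `det Z * (xᵀy - χᵀZ⁻¹υ)`. -/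
noncomputable def residualPoly (l m : Fin (r + 2)) :
    MvPolynomial {e : Fin (r + 2) × Fin (r + 2) // e.1 < e.2} ℝ :=
  (gramPoly r).det * innerPoly l m - ipPoly l ⬝ᵥ ((gramPoly r).adjugate *ᵥ ipPoly m)

/-- Evaluation at the inner products of the arguments. -/
noncomputable def evalInner {m : ℕ} (v : Fin m → Sph n) :
    MvPolynomial {e : Fin m × Fin m // e.1 < e.2} ℝ →ₐ[ℝ] ℝ :=
  aeval fun e => inner ℝ (v e.1.1 : Euc n) (v e.1.2 : Euc n)

theorem evalInner_innerPoly {m : ℕ} (v : Fin m → Sph n) (j k : Fin m) :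
    evalInner v (innerPoly j k) = inner ℝ (v j : Euc n) (v k : Euc n) :=
  eval_innerPoly v j k

theorem map_gramPoly (v : Fin (r + 2) → Sph n) :
    (gramPoly r).map (evalInner v) = gramMat fun j => v j.succ.succ := by
  ext j k
  exact evalInner_innerPoly v _ _

theorem evalInner_ipPoly (v : Fin (r + 2) → Sph n) (l : Fin (r + 2)) (j : Fin r) :
    evalInner v (ipPoly l j) = ipVec (fun j => v j.succ.succ) (v l) j :=
  evalInner_innerPoly v _ _

theorem evalInner_det_gramPoly (v : Fin (r + 2) → Sph n) :
    evalInner v (gramPoly r).det = (gramMat fun j => v j.succ.succ).det := by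
  rw [AlgHom.map_det, AlgHom.mapMatrix_apply, map_gramPoly]

/-- The adjugate is `det Z` times the inverse, so one factor of the determinant clears the
denominator. -/
theorem evalInner_residualPoly (v : Fin (r + 2) → Sph n)
    (hv : (gramMat fun j : Fin r => v j.succ.succ).det ≠ 0) (l m : Fin (r + 2)) :
    evalInner v (residualPoly l m) = (gramMat fun j : Fin r => v j.succ.succ).det *
      residualInner (v l) (v m) fun j => v j.succ.succ := by
  have hadj : (gramPoly r).adjugate.map (evalInner v) =
      (gramMat fun j : Fin r => v j.succ.succ).adjugate := by
    rw [← map_gramPoly]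
    exact AlgHom.map_adjugate (evalInner v) (gramPoly r)
  have hinv : (gramMat fun j : Fin r => v j.succ.succ).adjugate =
      (gramMat fun j : Fin r => v j.succ.succ).det •
        (gramMat fun j : Fin r => v j.succ.succ)⁻¹ := by
    rw [Matrix.inv_def, smul_smul, Ring.inverse_eq_inv', mul_inv_cancel₀ hv, one_smul]
  have hdot : evalInner v (ipPoly l ⬝ᵥ ((gramPoly r).adjugate *ᵥ ipPoly m)) =
      ipVec (fun j => v j.succ.succ) (v l) ⬝ᵥ
        ((gramMat fun j : Fin r => v j.succ.succ).adjugate *ᵥ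
          ipVec (fun j => v j.succ.succ) (v m)) := by
    rw [← hadj]
    simp only [dotProduct, Matrix.mulVec, map_sum, map_mul, evalInner_ipPoly, Matrix.map_apply]
  rw [residualPoly, map_sub, map_mul, evalInner_det_gramPoly, evalInner_innerPoly, hdot, hinv,
    Matrix.smul_mulVec, dotProduct_smul, smul_eq_mul, residualInner, mul_sub]

/-- The `i`-th term of the expansion as a polynomial in the inner products. -/
theorem exists_poly_expansionTerm (α : ℝ) (i d : ℕ)
    {C : Matrix (Fin r) (Fin r) ℝ → Matrix (MonomialIndex r d) (MonomialIndex r d) ℝ}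
    (hC : IsPolynomialMatrixOn (gramSet n r) C) :
    ∃ p : MvPolynomial {e : Fin (r + 2) × Fin (r + 2) // e.1 < e.2} ℝ,
      ∀ v : Fin (r + 2) → Sph n, (gramMat fun j : Fin r => v j.succ.succ).det ≠ 0 →
        evalInner v p = expansionTerm α i d (C (gramMat fun j => v j.succ.succ))
          (ipVec (fun j => v j.succ.succ) (v 0)) (ipVec (fun j => v j.succ.succ) (v 1))
          (gramMat fun j => v j.succ.succ).det
          (residualInner (v 0) (v 1) fun j => v j.succ.succ)
          (schurFactor (gramMat fun j => v j.succ.succ) (ipVec (fun j => v j.succ.succ) (v 0)) *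
            schurFactor (gramMat fun j => v j.succ.succ)
              (ipVec (fun j => v j.succ.succ) (v 1))) := by
  choose q hq using hC
  -- The last factor evaluates to `H_i(det Z * A, (det Z)² * B)`, which is `(det Z)^i * H_i(A, B)`.
  refine ⟨(∑ a, (∏ j, ipPoly 0 j ^ (a.1 j : ℕ)) * ∑ b, aeval (fun p => gramPoly r p.1 p.2) (q a b) *
    ∏ j, ipPoly 1 j ^ (b.1 j : ℕ)) *
      gegenbauerHom α (residualPoly 0 1) (residualPoly 0 0 * residualPoly 1 1) i, fun v hv => ?_⟩
  have hqv (a b) : evalInner v (aeval (fun p => gramPoly r p.1 p.2) (q a b)) =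
      C (gramMat fun j => v j.succ.succ) a b := by
    rw [hq a b _ ⟨_, rfl⟩, ← map_gramPoly, ← AlgHom.comp_apply, comp_aeval]
    rfl
  have hB : residualInner (v 0) (v 0) (fun j => v j.succ.succ) *
      residualInner (v 1) (v 1) (fun j => v j.succ.succ) = schurFactor
        (gramMat fun j => v j.succ.succ) (ipVec (fun j => v j.succ.succ) (v 0)) *
      schurFactor (gramMat fun j => v j.succ.succ) (ipVec (fun j => v j.succ.succ) (v 1)) := by
    rw [schurFactor_eq_residualInner, schurFactor_eq_residualInner]
  rw [expansionTerm, ← gegenbauerHom_mul_sq, ← hB, map_mul, map_gegenbauerHom, map_mul,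
    evalInner_residualPoly v hv, evalInner_residualPoly v hv, evalInner_residualPoly v hv]
  congr 1
  · simp only [map_sum, map_mul, map_prod, map_pow, evalInner_ipPoly, hqv]
    rfl
  · congr 1
    ring

end Polynomiality

theorem proposition8 (n r N : ℕ) (hn : r + 2 ≤ n)
    (F : (Fin (r + 2) → Sph n) → ℝ) (hFcont : Continuous F)
    (c : ℕ → (Fin r → ℝ) → (Fin r → ℝ) → Matrix (Fin r) (Fin r) ℝ → ℝ)
    (d : ℕ → ℕ)
    (C : (i : ℕ) → Matrix (Fin r) (Fin r) ℝ →
      Matrix (MonomialIndex r (d i)) (MonomialIndex r (d i)) ℝ)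
    (hCpsd : ∀ i ≤ N, ∀ Z ∈ gramSet n r, (C i Z).PosSemidef)
    (hshape : ∀ i ≤ N, ∀ (x y : Sph n) (z : Fin r → Sph n), IsRegularPoint x y z →
      c i (ipVec z x) (ipVec z y) (gramMat z) =
        shapeCoeff i (d i) (C i) (ipVec z x) (ipVec z y) (gramMat z))
    (hzero : ∀ i, N < i → ∀ (x y : Sph n) (z : Fin r → Sph n), IsRegularPoint x y z →
      c i (ipVec z x) (ipVec z y) (gramMat z) = 0)
    (hF : ∀ (x y : Sph n) (z : Fin r → Sph n), IsRegularPoint x y z →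
      HasSum (fun i => c i (ipVec z x) (ipVec z y) (gramMat z) *
          (gegenbauer (((n : ℝ) - r) / 2 - 1) i).eval (expansionArg x y z))
        (F (tuple x y z))) :
    Is2PSD F ∧ IsOrthogonalInvariant F ∧
      ((∀ i ≤ N, IsPolynomialMatrixOn (gramSet n r) (C i)) →
        IsPolynomialInInnerProducts F) := by
  refine ⟨is2PSD_of_posSemidef hFcont fun κ _ => ?_, ?_, fun hpoly => ?_⟩
  · refine posSemidef_of_generic (by omega) hFcont fun z x hreg hz => ?_
    convert Matrix.posSemidef_sum (Finset.range (N + 1)) fun i hi =>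
      posSemidef_expansionTerm (i := i) (d := d i) hn
        (hCpsd i (Nat.lt_succ_iff.mp (Finset.mem_range.mp hi)) _ ⟨z, rfl⟩) hz x using 1
    ext s t
    rw [Matrix.sum_apply]
    exact expansion_eq_sum (hreg s t) (fun i hi => hshape i hi _ _ _ (hreg s t))
      (fun i hi => hzero i hi _ _ _ (hreg s t)) (hF _ _ _ (hreg s t))
  · refine isOrthogonalInvariant_of_regular hn hFcont fun g x y z h => ?_
    have hg := hF _ _ _ (isRegularPoint_sphereRotate g h)
    simp only [gramMat_sphereRotate, ipVec_sphereRotate, expansionArg_sphereRotate] at hg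
    exact hg.unique (hF x y z h)
  · choose! p hp using fun (i : ℕ) (hi : i ≤ N) =>
      exists_poly_expansionTerm (((n : ℝ) - r) / 2 - 1) i (d i) (hpoly i hi)
    refine ⟨∑ i ∈ Finset.range (N + 1), p i, fun v => ?_⟩
    -- Both sides are continuous, so agreement on the dense set of linearly independent tuples
    -- suffices; one polynomial then serves degenerate tuples too.
    have hc : IsClosed {v : Fin (r + 2) → Sph n |
        F v = evalInner v (∑ i ∈ Finset.range (N + 1), p i)} := by
      refine isClosed_eq hFcont ((MvPolynomial.continuous_eval _).comp (continuous_pi fun e => ?_))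
      exact (continuous_subtype_val.comp (continuous_apply e.1.1)).inner
        (continuous_subtype_val.comp (continuous_apply e.1.2))
    refine closure_minimal (fun v hv => ?_) hc (dense_linearIndependent hn v)
    have h := isRegularPoint_of_linearIndependent hv
    have hs := expansion_eq_sum h (fun i hi => hshape i hi _ _ _ h)
      (fun i hi => hzero i hi _ _ _ h) (hF _ _ _ h)
    rw [tuple_eta] at hs
    change F v = _
    rw [hs, map_sum]
    exact Finset.sum_congr rfl fun i hi =>
      (hp i (Nat.lt_succ_iff.mp (Finset.mem_range.mp hi)) v h.1).symm
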